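/- Let $\mathcal T$ be a triangulated category with set-indexed coproducts and with a symmetric monoidal structure $(\otimes,\mathbf 1)$ such that $\otimes$ is exact and preserves set-indexed coproducts in each variable. Assume that $\mathcal T$ is compactly generated (there is a set $\mathcal G$ of compact objects such that $Y=0$ whenever $\operatorname{Hom}(G,\Sigma^nY)=0$ for all $G\in\mathcal G$ and $n\in\mathbb Z$), that the unit $\mathbf 1$ is compact, and that every compact object is strongly dualizable. Let $\mathcal T^c$ be the full subcategory of compact objects and let $\mathbf{Th}(\mathcal T^c)$ be the collection, ordered by inclusion, of thick subcategories $\mathsf C$ of $\mathcal T^c$ (triangulated subcategories closed under direct summands) that are tensor closed, i.e. $X\otimes Y\in\mathsf C$ for $X\in\mathsf C$, $Y\in\mathcal T^c$; it is a complete lattice in which infima are intersections. For an object $X$ of $\mathcal T$ let $A(X)=\{Y\in\mathcal T\mid X\otimes Y=0\}$ be its Bousfield class, and let the Bousfield lattice $\mathbf A(\mathcal T)$ be the collection of all Bousfield classes, ordered by $A(X)\le A(Y)$ if and only if $A(X)\supseteq A(Y)$. Then the following hold. (1) $\mathbf{Th}(\mathcal T^c)$ is a coherent frame: it satisfies $a\wedge\bigvee_i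 b_i=\bigvee_i(a\wedge b_i)$, every element is a supremum of compact elements, and the compact elements form a sublattice containing the greatest element. (2) For every class $\mathsf P$ of compact objects the supremum $\bigvee_{X\in\mathsf P}A(X)$ exists in $\mathbf A(\mathcal T)$. The map $f\colon\mathbf{Th}(\mathcal T^c)\to\mathbf A(\mathcal T)$, $f(\mathsf C)=\bigvee_{X\in\mathsf C}A(X)$, satisfies $\mathsf C\subseteq\mathsf D\iff f(\mathsf C)\le f(\mathsf D)$ (in particular it is injective), $f(\mathsf C\cap\mathsf D)=f(\mathsf C)\wedge f(\mathsf D)$ and $f(\bigvee_i\mathsf C_i)=\bigvee_i f(\mathsf C_i)$, where the infima and suprema on the right-hand sides are formed in $\mathbf A(\mathcal T)$ and exist there. Thus $f$ is an isomorphism of $\mathbf{Th}(\mathcal T^c)$ onto a sublattice of $\mathbf A(\mathcal T)$. This sublattice consists of all the elements $\bigvee_{X\in\mathsf P}A(X)$ with $\mathsf P$ an arbitrary class of compact objects. (3) Every element of the image of $f$ is Bousfield idempotent, i.e. belongs to $\mathbf D(\mathcal T)=\{A(X)\mid A(X)=A(X\otimes X)\}$. -/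

import Mathlib

open CategoryTheory Category Limits Pretriangulated MonoidalCategory ZeroObject

universe v u

namespace TensorTriangulated

section Compact

variable (T : Type u) [Category.{v} T] [Preadditive T] [HasCoproducts.{v} T]

/-- An object `X` is compact if every morphism from `X` to a set-indexed coproduct comes from a
finite subcoproduct, i.e. if the canonical map `⨁ Hom(X, Y i) → Hom(X, ∐ Y)` is surjective.
(This map is always injective, as one sees by composing with the projections `∐ Y ⟶ Y i`, so that
compactness means that `Hom(X, -)` preserves set-indexed coproducts.) -/
def compactObjects : ObjectProperty T := fun X =>
  ∀ (ι : Type v) (Y : ι → T) (f : X ⟶ ∐ Y),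
    ∃ (s : Finset ι) (g : ∀ i, X ⟶ Y i), f = ∑ i ∈ s, g i ≫ Sigma.ι Y i

end Compact

section Basic

variable (T : Type u) [Category.{v} T] [HasZeroObject T] [HasShift T ℤ] [Preadditive T]
  [∀ n : ℤ, (shiftFunctor T n).Additive] [Pretriangulated T]
  [MonoidalCategory T] [HasCoproducts.{v} T]

/-- Compactly generated tensor triangulated categories: the tensor product is exact and preserves
set-indexed coproducts in each variable (it suffices to say this for one variable, since this is
used for symmetric monoidal categories), there is a set of compact generators, the unit is
compact, and all compact objects are strongly dualizable. Exactness of the internal Hom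
in its contravariant variable is not required. -/
class CompactlyGenerated : Prop where
  exact_tensorLeft (X : T) : ∃ _ : (tensorLeft X).CommShift ℤ, (tensorLeft X).IsTriangulated
  preservesCoproducts_tensorLeft (X : T) (ι : Type v) :
    PreservesColimitsOfShape (Discrete ι) (tensorLeft X)
  exists_generators : ∃ (ι : Type v) (G : ι → T), (∀ i, compactObjects T (G i)) ∧
    ∀ Y : T, (∀ (i : ι) (n : ℤ) (f : G i ⟶ Y⟦n⟧), f = 0) → IsZero Y
  compact_unit : compactObjects T (𝟙_ T)
  dualizable (X : T) (hX : compactObjects T X) : ∃ Y : T, Nonempty (ExactPairing X Y)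

/-- The tensor closed thick subcategories of the category of compact objects: full triangulated
subcategories of compact objects, closed under direct summands, and closed under tensoring with
compact objects. -/
@[ext]
structure ThickTensorIdeal where
  prop : ObjectProperty T
  le_compact : prop ≤ compactObjects T
  triangulated : prop.IsTriangulated
  thick : prop.IsStableUnderRetracts
  tensor_mem (X Y : T) : prop X → compactObjects T Y → prop (X ⊗ Y)

instance : PartialOrder (ThickTensorIdeal T) :=
  PartialOrder.lift ThickTensorIdeal.prop (fun _ _ => ThickTensorIdeal.ext)

variable {T}

/-- The full subcategory `A(X)` of `X`-acyclic objects, i.e. of the `Y` with `X ⊗ Y = 0`. -/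
def acyclics (X : T) : ObjectProperty T := fun Y => IsZero (X ⊗ Y)

variable (T)

/-- The collection of Bousfield classes, i.e. of the subcategories of the form `A(X)`. -/
@[ext]
structure BousfieldLattice where
  prop : ObjectProperty T
  exists_eq : ∃ X : T, prop = acyclics X

/-- The order on Bousfield classes is reverse inclusion of subcategories. -/
instance : PartialOrder (BousfieldLattice T) :=
  PartialOrder.lift (fun a => OrderDual.toDual a.prop)
    (fun _ _ h => BousfieldLattice.ext (OrderDual.toDual.injective h))

variable {T}

/-- The Bousfield class `A(X)` of `X`, as an element of the Bousfield lattice. -/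
def bousfieldClass (X : T) : BousfieldLattice T := ⟨acyclics X, X, rfl⟩

variable (T)

/-- The set `D(T)` of Bousfield idempotent classes. -/
def bousfieldIdempotents : Set (BousfieldLattice T) :=
  {a | ∃ X : T, a = bousfieldClass X ∧ bousfieldClass X = bousfieldClass (X ⊗ X)}

end Basic

section Closure

lemma compactObjects_iff {T : Type u} [Category.{v} T] [Preadditive T] [HasCoproducts.{v} T]
    (X : T) : compactObjects T X ↔ ∀ (ι : Type v) (Y : ι → T) (f : X ⟶ ∐ Y),
      ∃ (s : Finset ι) (p : ∀ i, ∐ Y ⟶ Y i), f ≫ (𝟙 _ - ∑ i ∈ s, p i ≫ Sigma.ι Y i) = 0 := by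
  classical
  constructor
  · intro h ι Y f
    obtain ⟨s, g, rfl⟩ := h ι Y f
    refine ⟨s, fun i => Sigma.desc (fun j => if h : j = i then eqToHom (by rw [h]) else 0), ?_⟩
    rw [Preadditive.comp_sub, comp_id, sub_eq_zero, Preadditive.sum_comp]
    refine Finset.sum_congr rfl fun j hj => ?_
    rw [Preadditive.comp_sum, Finset.sum_eq_single j]
    · simp
    · intro i _ hij
      simp [hij.symm]
    · exact fun h => (h hj).elim
  · intro h ι Y f
    obtain ⟨s, p, hp⟩ := h ι Y f
    refine ⟨s, fun i => f ≫ p i, ?_⟩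
    rw [Preadditive.comp_sub, comp_id, sub_eq_zero] at hp
    simpa [Preadditive.comp_sum] using hp

variable (T : Type u) [Category.{v} T] [HasZeroObject T] [HasShift T ℤ] [Preadditive T]
  [∀ n : ℤ, (shiftFunctor T n).Additive] [Pretriangulated T] [HasCoproducts.{v} T]

instance compactObjects_retracts : (compactObjects T).IsStableUnderRetracts where
  of_retract {X Z} r hZ := by
    intro ι Y f
    obtain ⟨s, g, hg⟩ := hZ ι Y (r.r ≫ f)
    refine ⟨s, fun i => r.i ≫ g i, ?_⟩
    have := congrArg (fun t => r.i ≫ t) hg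
    simpa [Preadditive.comp_sum] using this

instance compactObjects_triangulated : (compactObjects T).IsTriangulated where
  exists_zero := ⟨0, isZero_zero T, fun ι Y f =>
    ⟨∅, fun _ => 0, (isZero_zero T).eq_of_src _ _⟩⟩
  isStableUnderShiftBy n := ⟨by
    intro X hX ι Y f
    -- transport `f` along the shift by `-n`, an equivalence which preserves coproducts
    let F := shiftFunctor T (-n)
    let e : (X⟦n⟧)⟦-n⟧ ≅ X := (shiftEquiv T n).unitIso.symm.app X
    let c := PreservesCoproduct.iso F Y
    obtain ⟨s, g, hg⟩ := hX ι (fun i => F.obj (Y i)) (e.inv ≫ F.map f ≫ c.hom)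
    refine ⟨s, fun i => F.preimage (e.hom ≫ g i), F.map_injective ?_⟩
    have h1 : F.map f = e.hom ≫ (∑ i ∈ s, g i ≫ Sigma.ι (fun i => F.obj (Y i)) i) ≫ c.inv := by
      rw [← hg]; simp
    have h2 : ∀ i, Sigma.ι (fun i => F.obj (Y i)) i ≫ c.inv = F.map (Sigma.ι Y i) := by
      intro i
      simp [c]
    rw [h1, F.map_sum, Preadditive.sum_comp, Preadditive.comp_sum]
    refine Finset.sum_congr rfl fun i _ => ?_
    rw [F.map_comp, F.map_preimage, assoc, assoc, h2]⟩
  toIsTriangulatedClosed₂ := .mk' (by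
    intro D hD h₁ h₃ ι Y f
    obtain ⟨s, p, hp⟩ := (compactObjects_iff _).1 h₁ ι Y (D.mor₁ ≫ f)
    obtain ⟨g, hg⟩ := D.yoneda_exact₂ hD (f ≫ (𝟙 _ - ∑ i ∈ s, p i ≫ Sigma.ι Y i))
      (by rw [← assoc]; exact hp)
    obtain ⟨t, q, hq⟩ := h₃ ι Y g
    classical
    refine ⟨s ∪ t, fun i => (if i ∈ s then f ≫ p i else 0) +
      (if i ∈ t then D.mor₂ ≫ q i else 0), ?_⟩
    rw [hq, Preadditive.comp_sub, comp_id, sub_eq_iff_eq_add] at hg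
    refine hg.trans ?_
    simp only [Preadditive.add_comp, Finset.sum_add_distrib, ite_comp, zero_comp,
      Preadditive.comp_sum, assoc]
    rw [add_comm]
    congr 1
    · rw [← Finset.sum_filter, Finset.filter_mem_eq_inter, Finset.union_inter_cancel_left]
    · rw [← Finset.sum_filter, Finset.filter_mem_eq_inter, Finset.union_inter_cancel_right])

variable [MonoidalCategory T] [SymmetricCategory T] [CompactlyGenerated T]

lemma compactObjects_tensor (X Y : T) (hX : compactObjects T X) (hY : compactObjects T Y) :
    compactObjects T (X ⊗ Y) := by
  intro ι Z f
  obtain ⟨D, ⟨_⟩⟩ := CompactlyGenerated.dualizable X hX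
  let _ : ExactPairing D X := BraidedCategory.exactPairing_swap X D
  have _ := CompactlyGenerated.preservesCoproducts_tensorLeft D ι
  obtain ⟨_, _⟩ := CompactlyGenerated.exact_tensorLeft D
  let c := PreservesCoproduct.iso (tensorLeft D) Z
  obtain ⟨s, g, hg⟩ := hY ι (fun i => D ⊗ Z i) (tensorLeftHomEquiv _ D X _ f ≫ c.hom)
  refine ⟨s, fun i => (tensorLeftHomEquiv _ D X _).symm (g i), ?_⟩
  have h2 : ∀ i, Sigma.ι (fun i => D ⊗ Z i) i ≫ c.inv = D ◁ (Sigma.ι Z i) := by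
    intro i
    simpa [c] using ι_comp_sigmaComparison (tensorLeft D) Z i
  have hw : ∀ {B : T} (k : ι → (X ⊗ Y ⟶ B)),
      tensorLeftHomEquiv _ D X _ (∑ i ∈ s, k i) = ∑ i ∈ s, tensorLeftHomEquiv _ D X _ (k i) := by
    intro B k
    have : D ◁ (∑ i ∈ s, k i) = ∑ i ∈ s, D ◁ k i := (tensorLeft D).map_sum k s
    simp [tensorLeftHomEquiv, this, Preadditive.comp_sum]
  apply (tensorLeftHomEquiv _ D X _).injective
  rw [← cancel_mono c.hom, hg, hw, Preadditive.sum_comp]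
  refine Finset.sum_congr rfl fun i _ => ?_
  rw [tensorLeftHomEquiv_naturality, Equiv.apply_symm_apply, ← h2, assoc, assoc, c.inv_hom_id]
  simp

end Closure

section Lattice

variable (T : Type u) [Category.{v} T] [HasZeroObject T] [HasShift T ℤ] [Preadditive T]
  [∀ n : ℤ, (shiftFunctor T n).Additive] [Pretriangulated T]
  [MonoidalCategory T] [SymmetricCategory T] [HasCoproducts.{v} T] [CompactlyGenerated T]

/-- Infima of tensor closed thick subcategories are intersections (within the compact objects). -/
instance : InfSet (ThickTensorIdeal T) where
  sInf S :=
    { prop := fun X => compactObjects T X ∧ ∀ C ∈ S, C.prop X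
      le_compact := fun _ h => h.1
      triangulated :=
        { exists_zero := ⟨0, isZero_zero T,
            ObjectProperty.prop_of_isZero _ (isZero_zero T), fun C _ =>
              have := C.triangulated; have := C.thick
              ObjectProperty.prop_of_isZero _ (isZero_zero T)⟩
          isStableUnderShiftBy := fun n => ⟨fun X hX =>
            ⟨(compactObjects T).le_shift n X hX.1, fun C hC =>
              have := C.triangulated
              C.prop.le_shift n X (hX.2 C hC)⟩⟩
          ext₂' := fun D hD h₁ h₃ => ObjectProperty.le_isoClosure _ _
            ⟨(compactObjects T).ext_of_isTriangulatedClosed₂ D hD h₁.1 h₃.1, fun C hC =>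
              have := C.triangulated; have := C.thick
              C.prop.ext_of_isTriangulatedClosed₂ D hD (h₁.2 C hC) (h₃.2 C hC)⟩ }
      thick := ⟨fun r h => ⟨(compactObjects T).prop_of_retract r h.1, fun C hC =>
        have := C.thick
        C.prop.prop_of_retract r (h.2 C hC)⟩⟩
      tensor_mem := fun X Y hX hY =>
        ⟨compactObjects_tensor T X Y hX.1 hY, fun C hC => C.tensor_mem X Y (hX.2 C hC) hY⟩ }

instance : CompleteLattice (ThickTensorIdeal T) :=
  completeLatticeOfInf _ fun _ =>
    ⟨fun C hC _ hX => hX.2 C hC,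
      fun D hD X hX => And.intro (D.le_compact X hX) (fun _ hC => hD hC X hX)⟩

end Lattice

/-- A coherent frame: a complete lattice satisfying the infinite distributive law, in which every
element is a supremum of compact elements, and in which the compact elements form a sublattice
containing the top element. -/
structure IsCoherentFrame (L : Type*) [CompleteLattice L] : Prop where
  inf_sSup_eq (a : L) (S : Set L) : a ⊓ sSup S = ⨆ b ∈ S, a ⊓ b
  compactlyGenerated (a : L) : ∃ S : Set L, (∀ x ∈ S, IsCompactElement x) ∧ sSup S = a
  compact_top : IsCompactElement (⊤ : L)
  compact_sup (a b : L) : IsCompactElement a → IsCompactElement b → IsCompactElement (a ⊔ b)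
  compact_inf (a b : L) : IsCompactElement a → IsCompactElement b → IsCompactElement (a ⊓ b)

end TensorTriangulated

open TensorTriangulated

/-! Each ideal `C` has a finite localization triangle `Γ ⟶ 𝟙 ⟶ L` (`exists_idempotent_triangle`),
where `L` is the homotopy colimit of a tower that starts at the unit and repeatedly cones off all
maps from a skeleton of `C`. Objects of `C` kill `L`, since their duals again lie in `C` and `C` has
no nonzero maps to `L`. Conversely, `Γ` kills whatever `C` kills. So the intersection of the `A(X)`
with `X` in `C` is the single class `A(Γ)`, and this is `f(C)`; the isomorphisms `X ≅ X ⊗ Γ` for `X`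
in `C` make it idempotent.

The ideal is recovered from `L`. If `X` is compact with dual `Y` and `X ⊗ L = 0`, the evaluation `Y
⊗ X ⟶ 𝟙` vanishes in `L`, hence at a finite stage of the tower, hence factors through some `c` in
`C`. A triangle identity then makes `X` a retract of `X ⊗ c`. Thus `f` reflects the order.

The compact objects killed by a fixed object form an ideal, so suprema of classes of compact objects
depend only on the ideal generated. Infima are preserved because `Z ≅ Z ⊗ Γ` whenever `Z` kills all
that `C` kills.

For the frame laws, `X` is a retract of `X ⊗ Y ⊗ X`, so every ideal is radical. With quotient ideals
this gives distributivity; the compact elements are the principal ideals, which meet by tensoring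
generators. -/

namespace TensorTriangulated

/-! ### Compact objects and coproducts -/

section Coproducts

variable {T : Type u} [Category.{v} T] [Preadditive T]

lemma compactObjects.exists_eq_sum [HasCoproducts.{v} T] {K : T} (hK : compactObjects T K)
    {ι : Type v} {Y : ι → T} {S : T} {inj : ∀ i, Y i ⟶ S} (hS : IsColimit (Cofan.mk S inj))
    (f : K ⟶ S) : ∃ (s : Finset ι) (g : ∀ i, K ⟶ Y i), f = ∑ i ∈ s, g i ≫ inj i := by
  let e : S ≅ ∐ Y := hS.coconePointUniqueUpToIso (coproductIsCoproduct Y)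
  have he : ∀ i, Sigma.ι Y i ≫ e.inv = inj i := fun i =>
    hS.comp_coconePointUniqueUpToIso_inv (coproductIsCoproduct Y) ⟨i⟩
  obtain ⟨s, g, h⟩ := hK ι Y (f ≫ e.hom)
  refine ⟨s, g, ?_⟩
  rw [← cancel_mono e.hom, h, Preadditive.sum_comp]
  refine Finset.sum_congr rfl fun i _ => ?_
  rw [← he, assoc, assoc, e.inv_hom_id, comp_id]

lemma isZero_of_isColimit_cofan {ι : Type v} {Y : ι → T} {S : T} {inj : ∀ i, Y i ⟶ S}
    (hS : IsColimit (Cofan.mk S inj)) (h : ∀ i, IsZero (Y i)) : IsZero S := by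
  rw [IsZero.iff_id_eq_zero]
  exact hS.hom_ext fun i => (h i.as).eq_of_src _ _

end Coproducts

variable {T : Type u} [Category.{v} T] [HasZeroObject T] [HasShift T ℤ] [Preadditive T]
  [∀ n : ℤ, (shiftFunctor T n).Additive] [Pretriangulated T]

section Exactness

variable {A B C D : T} {a : A ⟶ B} {b : B ⟶ C} {c : C ⟶ A⟦(1 : ℤ)⟧}
  (h : Triangle.mk a b c ∈ distTriang T)
include h

lemma exists_lift₁ {f : D ⟶ B} (hf : f ≫ b = 0) : ∃ g : D ⟶ A, f = g ≫ a :=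
  Triangle.coyoneda_exact₂ _ h f hf

lemma exists_lift₂ {f : D ⟶ C} (hf : f ≫ c = 0) : ∃ g : D ⟶ B, f = g ≫ b :=
  Triangle.coyoneda_exact₃ _ h f hf

lemma exists_desc₂ {f : B ⟶ D} (hf : a ≫ f = 0) : ∃ g : C ⟶ D, f = b ≫ g :=
  Triangle.yoneda_exact₂ _ h f hf

lemma comp_eq_zero₁₂ : a ≫ b = 0 := comp_distTriang_mor_zero₁₂ _ h

lemma comp_eq_zero₃₁ : c ≫ a⟦(1 : ℤ)⟧' = 0 := comp_distTriang_mor_zero₃₁ _ h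

end Exactness

/-- A homotopy colimit of a sequence `X` of objects in a triangulated category: an object `L`
together with a distinguished triangle `∐ X n ⟶ ∐ X n ⟶ L ⟶` whose first morphism is the difference
of the identity and the shift. -/
structure Telescope (X : ℕ ⥤ T) (L : T) where
  sum : T
  inj (n : ℕ) : X.obj n ⟶ sum
  -- An arbitrary coproduct cofan, so that exact coproduct-preserving functors carry telescopes to
  -- telescopes.
  isColimit : IsColimit (Cofan.mk (f := fun n : ULift.{v} ℕ => X.obj n.down) sum
    (fun n => inj n.down))
  diff : sum ⟶ sum
  inj_diff (n : ℕ) : inj n ≫ diff = inj n - X.map (homOfLE n.le_succ) ≫ inj (n + 1)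
  proj : sum ⟶ L
  δ : L ⟶ sum⟦(1 : ℤ)⟧
  distinguished : Triangle.mk diff proj δ ∈ distTriang T

/-! ### Homotopy colimits and maps into them from compact objects -/

namespace Telescope

variable {X : ℕ ⥤ T} {L : T}

lemma exists_telescope [HasCoproducts.{v} T] (X : ℕ ⥤ T) : ∃ L, Nonempty (Telescope X L) := by
  let Y := fun n : ULift.{v} ℕ => X.obj n.down
  let d : ∐ Y ⟶ ∐ Y := Sigma.desc fun n => Sigma.ι Y n -
    X.map (homOfLE n.down.le_succ) ≫ Sigma.ι Y ⟨n.down + 1⟩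
  obtain ⟨L, p, δ, h⟩ := distinguished_cocone_triangle d
  exact ⟨L, ⟨⟨∐ Y, fun n => Sigma.ι Y ⟨n⟩, coproductIsCoproduct Y, d, fun n => by simp [d, Y],
    p, δ, h⟩⟩⟩

/-- The image of a telescope under an exact functor preserving coproducts. -/
noncomputable def map (t : Telescope X L) (F : T ⥤ T) [F.CommShift ℤ] [F.IsTriangulated]
    [PreservesColimitsOfShape (Discrete (ULift.{v} ℕ)) F] : Telescope (X ⋙ F) (F.obj L) where
  sum := F.obj t.sum
  inj n := F.map (t.inj n)
  isColimit := isColimitCofanMkObjOfIsColimit F _ _ t.isColimit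
  diff := F.map t.diff
  inj_diff n := by
    rw [← F.map_comp, t.inj_diff, F.map_sub, F.map_comp]
    rfl
  proj := F.map t.proj
  δ := F.map t.δ ≫ (F.commShiftIso (1 : ℤ)).hom.app t.sum
  distinguished := F.map_distinguished _ t.distinguished

variable (t : Telescope X L)

lemma hom_ext {Z : T} {f g : t.sum ⟶ Z} (h : ∀ n, t.inj n ≫ f = t.inj n ≫ g) : f = g :=
  t.isColimit.hom_ext fun n => h n.as.down

/-- The morphism out of the coproduct with given components. -/
noncomputable def desc {Z : T} (f : ∀ n, X.obj n ⟶ Z) : t.sum ⟶ Z :=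
  Cofan.IsColimit.desc t.isColimit fun n => f n.down

lemma inj_desc {Z : T} (f : ∀ n, X.obj n ⟶ Z) (n : ℕ) : t.inj n ≫ t.desc f = f n :=
  Cofan.IsColimit.fac t.isColimit (fun n => f n.down) ⟨n⟩

/-- The canonical morphism from the `n`-th term to the homotopy colimit. -/
def incl (n : ℕ) : X.obj n ⟶ L := t.inj n ≫ t.proj

lemma map_succ_incl (n : ℕ) : X.map (homOfLE n.le_succ) ≫ t.incl (n + 1) = t.incl n := by
  have h : t.inj n ≫ t.diff ≫ t.proj = 0 := by
    rw [comp_eq_zero₁₂ t.distinguished, comp_zero]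
  rw [← assoc, t.inj_diff, Preadditive.sub_comp, sub_eq_zero, assoc] at h
  exact h.symm

lemma map_incl {n m : ℕ} (h : n ≤ m) : X.map (homOfLE h) ≫ t.incl m = t.incl n := by
  induction m, h using Nat.le_induction with
  | base => simp
  | succ m h ih =>
    rw [← ih, ← t.map_succ_incl m, ← assoc, ← X.map_comp]
    rfl

/-- The projection of the coproduct onto the `N`-th term. -/
noncomputable def component (N : ℕ) : t.sum ⟶ X.obj N :=
  t.desc fun n => if h : n = N then X.map (homOfLE h.le) else 0

/-- The morphism from the coproduct to the `N`-th term given by the transition maps. -/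
noncomputable def truncate (N : ℕ) : t.sum ⟶ X.obj N :=
  t.desc fun n => if h : n ≤ N then X.map (homOfLE h) else 0

lemma inj_component (N : ℕ) : t.inj N ≫ t.component N = 𝟙 _ := by
  rw [component, inj_desc, dif_pos rfl]
  exact X.map_id N

lemma inj_component_of_ne {n N : ℕ} (h : n ≠ N) : t.inj n ≫ t.component N = 0 := by
  rw [component, inj_desc, dif_neg h]

lemma inj_truncate {n N : ℕ} (h : n ≤ N) : t.inj n ≫ t.truncate N = X.map (homOfLE h) := by
  rw [truncate, inj_desc, dif_pos h]

/-- On each summand the two terms of `diff` cancel before `N` and both vanish after `N`; only the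
`N`-th survives. -/
lemma diff_truncate (N : ℕ) : t.diff ≫ t.truncate N = t.component N := by
  refine t.hom_ext fun n => ?_
  rw [← assoc, t.inj_diff, Preadditive.sub_comp, assoc]
  rcases lt_trichotomy n N with h | rfl | h
  · rw [t.inj_truncate h.le, t.inj_truncate h, ← X.map_comp, t.inj_component_of_ne h.ne]
    exact sub_self _
  · rw [t.inj_truncate le_rfl, t.inj_component, truncate, inj_desc, dif_neg (by lia), comp_zero,
      sub_zero]
    exact X.map_id n
  · rw [t.inj_component_of_ne h.ne', truncate, inj_desc, inj_desc, dif_neg (by lia),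
      dif_neg (by lia), comp_zero, sub_zero]

section Compact

variable [HasCoproducts.{v} T] {K : T} (hK : compactObjects T K)
include hK

lemma exists_map_eq_zero {n : ℕ} (g : K ⟶ X.obj n) (hg : g ≫ t.incl n = 0) :
    ∃ (m : ℕ) (h : n ≤ m), g ≫ X.map (homOfLE h) = 0 := by
  obtain ⟨h, hh⟩ := exists_lift₁ t.distinguished (f := g ≫ t.inj n)
    (by rw [assoc]; exact hg)
  obtain ⟨s, k, rfl⟩ := hK.exists_eq_sum t.isColimit h
  -- With `N` beyond `n` and the finite support of the lift, `diff ≫ truncate N` is a component on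
  -- which the lift vanishes.
  obtain ⟨N, hN⟩ := (insert n (s.image ULift.down)).exists_nat_subset_range
  have hn : n < N := by simpa using hN (Finset.mem_insert_self _ _)
  refine ⟨N, hn.le, ?_⟩
  rw [← t.inj_truncate hn.le, ← assoc, hh]
  rw [assoc, t.diff_truncate, Preadditive.sum_comp]
  refine Finset.sum_eq_zero fun i hi => ?_
  have : i.down < N := by
    simpa using hN (Finset.mem_insert_of_mem (Finset.mem_image_of_mem _ hi))
  rw [assoc, t.inj_component_of_ne this.ne, comp_zero]

lemma exists_eq_comp_incl (f : K ⟶ L) : ∃ (n : ℕ) (g : K ⟶ X.obj n), f = g ≫ t.incl n := by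
  -- The map `f ≫ δ` is a finite sum killed by the shift of `diff`, so following by `truncate` shows
  -- that each component is zero.
  have hδ : f ≫ t.δ = 0 := by
    obtain ⟨s, k, hk⟩ := hK.exists_eq_sum (isColimitCofanMkObjOfIsColimit (shiftFunctor T (1 : ℤ))
      _ _ t.isColimit) (f ≫ t.δ)
    have h0 : (f ≫ t.δ) ≫ t.diff⟦(1 : ℤ)⟧' = 0 := by
      rw [assoc, comp_eq_zero₃₁ t.distinguished, comp_zero]
    rw [hk]
    refine Finset.sum_eq_zero fun i hi => ?_
    have h1 : (f ≫ t.δ) ≫ (t.component i.down)⟦(1 : ℤ)⟧' = 0 := by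
      rw [← t.diff_truncate, Functor.map_comp, ← assoc, h0, zero_comp]
    rw [hk, Preadditive.sum_comp, Finset.sum_eq_single i] at h1
    · rw [assoc, ← Functor.map_comp, t.inj_component, CategoryTheory.Functor.map_id, comp_id] at h1
      rw [h1, zero_comp]
    · intro j _ hj
      rw [assoc, ← Functor.map_comp, t.inj_component_of_ne (fun h => hj (ULift.ext _ _ h)),
        Functor.map_zero, comp_zero]
    · exact fun h => (h hi).elim
  obtain ⟨h, hh⟩ := exists_lift₂ t.distinguished hδ
  obtain ⟨s, k, rfl⟩ := hK.exists_eq_sum t.isColimit h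
  obtain ⟨N, hN⟩ := (s.image ULift.down).exists_nat_subset_range
  have hs : ∀ i ∈ s, i.down ≤ N := fun i hi => by
    have := hN (Finset.mem_image_of_mem _ hi)
    simp at this
    lia
  refine ⟨N, ∑ i ∈ s.attach, k i ≫ X.map (homOfLE (hs i i.2)), ?_⟩
  rw [hh, Preadditive.sum_comp, Preadditive.sum_comp, ← Finset.sum_attach]
  refine Finset.sum_congr rfl fun i _ => ?_
  rw [assoc, assoc, t.map_incl]
  rfl

end Compact

end Telescope

end TensorTriangulated

namespace TensorTriangulated

variable {T : Type u} [Category.{v} T] [HasZeroObject T] [HasShift T ℤ] [Preadditive T]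
  [∀ n : ℤ, (shiftFunctor T n).Additive] [Pretriangulated T]

/-- A finite sum of morphisms factoring through objects of a triangulated subcategory factors
through an object of this subcategory. -/
lemma exists_factorization_sum (P : ObjectProperty T) [P.IsTriangulated]
    [P.IsClosedUnderIsomorphisms] {ι : Type*} (s : Finset ι) {K S : T} {Y : ι → T}
    (hY : ∀ i, P (Y i)) (g : ∀ i, K ⟶ Y i) (k : ∀ i, Y i ⟶ S) :
    ∃ (D : T) (_ : P D) (a : K ⟶ D) (b : D ⟶ S), ∑ i ∈ s, g i ≫ k i = a ≫ b := by
  classical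
  induction s using Finset.induction_on with
  | empty => exact ⟨0, P.prop_zero, 0, 0, by simp⟩
  | insert i s hi ih =>
    obtain ⟨D, hD, a, b, h⟩ := ih
    refine ⟨Y i ⊞ D, P.ext_of_isTriangulatedClosed₂ _
      (binaryBiproductTriangle_distinguished _ _) (hY i) hD, biprod.lift (g i) a,
      biprod.desc (k i) b, ?_⟩
    rw [Finset.sum_insert hi, h, biprod.lift_desc]

/-! ### Towers and localization away from a small family of compact objects -/

section Cover

variable {T : Type u} [Category.{v} T] [HasCoproducts.{v} T] {ι : Type v} (G : ι → T)

/-- The canonical morphism to `X` from a coproduct of copies of the objects `G i`. -/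
noncomputable def cover (X : T) : ∐ (fun p : Σ i, (G i ⟶ X) => G p.1) ⟶ X :=
  Sigma.desc fun p => p.2

lemma ι_cover {X : T} (i : ι) (g : G i ⟶ X) :
    Sigma.ι (fun p : Σ i, (G i ⟶ X) => G p.1) ⟨i, g⟩ ≫ cover G X = g := by
  simp [cover]

end Cover

section Tower

variable [HasCoproducts.{v} T] {ι : Type v} (G : ι → T)

/-- A sequence of objects in which every term is the cone of the canonical morphism from a coproduct
of objects `G i` to the previous term. -/
def IsTower (X : ℕ ⥤ T) : Prop :=
  ∀ n, ∃ δ, Triangle.mk (cover G (X.obj n)) (X.map (homOfLE n.le_succ)) δ ∈ distTriang T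

lemma exists_isTower (X₀ : T) : ∃ X : ℕ ⥤ T, X.obj 0 = X₀ ∧ IsTower G X := by
  choose C p h using fun X => distinguished_cocone_triangle (cover G X)
  let Y (n : ℕ) : T := n.rec X₀ fun _ X => C X
  refine ⟨Functor.ofSequence (X := Y) fun n => p (Y n), rfl, fun n => ?_⟩
  obtain ⟨δ, hδ⟩ := h (Y n)
  refine ⟨δ, ?_⟩
  have := Functor.ofSequence_map_homOfLE_succ (X := Y) (fun n => p (Y n)) n
  exact this ▸ hδ

variable {G} {X : ℕ ⥤ T}

lemma IsTower.comp_map (hX : IsTower G X) {n : ℕ} (i : ι) (g : G i ⟶ X.obj n) :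
    g ≫ X.map (homOfLE n.le_succ) = 0 := by
  obtain ⟨δ, h⟩ := hX n
  rw [← ι_cover G i g, assoc, comp_eq_zero₁₂ h, comp_zero]

/-- If a morphism from a compact object to a term of a tower vanishes in a later term, then it
vanishes after composition with a morphism whose cone is built from the `G i`. -/
lemma IsTower.exists_trW (hX : IsTower G X) [IsTriangulated T] {P : ObjectProperty T}
    [P.IsTriangulated] [P.IsClosedUnderIsomorphisms] (hP : P ≤ compactObjects T)
    (hG : ∀ i, P (G i)) {n m : ℕ} (h : n ≤ m) {K : T} (hK : compactObjects T K)
    (g : K ⟶ X.obj n) (hg : g ≫ X.map (homOfLE h) = 0) :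
    ∃ (K' : T) (s : K' ⟶ K), P.trW s ∧ s ≫ g = 0 := by
  induction h using Nat.decreasingInduction with
  | self =>
    refine ⟨K, 𝟙 K, MorphismProperty.id_mem _ _, ?_⟩
    rw [id_comp, ← hg]
    exact ((congrArg (g ≫ ·) (X.map_id m)).trans (comp_id g)).symm
  | of_succ n h ih =>
    obtain ⟨K', s, hs, h0⟩ := ih (g ≫ X.map (homOfLE n.le_succ)) (by
      rw [assoc, ← X.map_comp]
      exact hg)
    have hK' : compactObjects T K' := by
      obtain ⟨D, a, b, hD, hPD⟩ := hs
      exact (compactObjects T).ext_of_isTriangulatedClosed₁ _ hD hK (hP _ hPD)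
    obtain ⟨δ, hδ⟩ := hX n
    -- The map `s ≫ g` lifts to the coproduct being coned off and, by compactness, factors through a
    -- finite sum `D` in `P`. The fibre of `K' ⟶ D` kills it; the octahedral axiom keeps the cone of
    -- the composite in `P`.
    obtain ⟨k, hk⟩ := exists_lift₁ hδ (f := s ≫ g) (by rw [assoc, h0])
    obtain ⟨J, l, rfl⟩ := hK' _ _ k
    obtain ⟨D, hD, a, b, hab⟩ := exists_factorization_sum P J (fun p => hG p.1) l
      (Sigma.ι (fun p : Σ i, (G i ⟶ X.obj n) => G p.1))
    obtain ⟨K'', r, c, hr⟩ := distinguished_cocone_triangle₁ a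
    refine ⟨K'', r ≫ s, MorphismProperty.comp_mem _ _ _ ⟨_, _, _, hr, hD⟩ hs, ?_⟩
    rw [assoc, hk, hab, assoc, ← assoc, comp_eq_zero₁₂ hr, zero_comp]

/-- The cone of the canonical morphism from a term of a sequence of isomorphisms to the homotopy
colimit receives no nonzero morphisms from compact objects. -/
lemma Telescope.eq_zero_of_isIso {L : T} (t : Telescope X L)
    (hX : ∀ n : ℕ, IsIso (X.map (homOfLE n.le_succ))) {Z : T} {v : L ⟶ Z} {w : Z ⟶ (X.obj 0)⟦(1 : ℤ)⟧}
    (hZ : Triangle.mk (t.incl 0) v w ∈ distTriang T) {K : T} (hK : compactObjects T K)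
    (f : K ⟶ Z) : f = 0 := by
  have iso : ∀ n m (h : n ≤ m), IsIso (X.map (homOfLE h)) := fun n m h => by
    induction m, h using Nat.le_induction with
    | base => exact (X.map_id n) ▸ inferInstance
    | succ m h ih =>
      rw [show homOfLE (h.trans m.le_succ) = homOfLE h ≫ homOfLE m.le_succ from rfl, X.map_comp]
      infer_instance
  have hf : f ≫ w = 0 := by
    -- Desuspended, `f ≫ w` is a map to `X.obj 0` that vanishes in `L`, hence at a finite stage,
    -- hence already at stage `0`.
    let e : (K⟦(-1 : ℤ)⟧)⟦(1 : ℤ)⟧ ≅ K := (shiftEquiv T (1 : ℤ)).counitIso.app K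
    let a : K⟦(-1 : ℤ)⟧ ⟶ X.obj 0 := (shiftFunctor T (1 : ℤ)).preimage (e.hom ≫ f ≫ w)
    have ha : a⟦(1 : ℤ)⟧' = e.hom ≫ f ≫ w := (shiftFunctor T (1 : ℤ)).map_preimage _
    have h0 : a ≫ t.incl 0 = 0 := (shiftFunctor T (1 : ℤ)).map_injective (by
      rw [Functor.map_comp, ha, assoc, assoc, comp_eq_zero₃₁ hZ, comp_zero, comp_zero,
        Functor.map_zero])
    obtain ⟨m, hm, h1⟩ := t.exists_map_eq_zero ((compactObjects T).le_shift (-1) _ hK) a h0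
    have := iso 0 m hm
    rw [← cancel_epi e.hom, ← ha, comp_zero, zero_of_comp_mono _ h1, Functor.map_zero]
  obtain ⟨k, rfl⟩ := exists_lift₂ hZ hf
  obtain ⟨n, g, rfl⟩ := t.exists_eq_comp_incl hK k
  have := iso 0 n n.zero_le
  have h : t.incl n = inv (X.map (homOfLE n.zero_le)) ≫ t.incl 0 := by
    rw [IsIso.eq_inv_comp, t.map_incl]
  rw [h, assoc, assoc, comp_eq_zero₁₂ hZ, comp_zero, comp_zero]

lemma IsTower.isIso_map (hX : IsTower G X) (F : T ⥤ T) [F.CommShift ℤ] [F.IsTriangulated]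
    (hF : ∀ ι : Type v, PreservesColimitsOfShape (Discrete ι) F)
    (h : ∀ i, IsZero (F.obj (G i))) (n : ℕ) : IsIso (F.map (X.map (homOfLE n.le_succ))) := by
  obtain ⟨δ, hδ⟩ := hX n
  exact (Triangle.isZero₁_iff_isIso₂ _ (F.map_distinguished _ hδ)).1
    (isZero_of_isColimit_cofan (isColimitCofanMkObjOfIsColimit F _ _
      (coproductIsCoproduct fun p : Σ i, (G i ⟶ X.obj n) => G p.1)) fun p => h p.1)

variable (G) in
/-- The localization of an object `X₀` away from a small family of compact objects. -/
theorem exists_localization [IsTriangulated T] (hG : ∀ i, compactObjects T (G i)) (X₀ : T) :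
    ∃ (L Z : T) (u : X₀ ⟶ L) (v : L ⟶ Z) (w : Z ⟶ X₀⟦(1 : ℤ)⟧),
      Triangle.mk u v w ∈ distTriang T ∧
      (∀ i (g : G i ⟶ L), g = 0) ∧
      (∀ (P : ObjectProperty T) [P.IsTriangulated] [P.IsClosedUnderIsomorphisms],
        P ≤ compactObjects T → (∀ i, P (G i)) → ∀ {K : T}, compactObjects T K →
        ∀ g : K ⟶ X₀, g ≫ u = 0 → ∃ (K' : T) (s : K' ⟶ K), P.trW s ∧ s ≫ g = 0) ∧
      -- Vanishing of `F.obj Z` is only tested on compact objects, as generation is not assumed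
      -- here.
      (∀ (F : T ⥤ T) [F.CommShift ℤ] [F.IsTriangulated],
        (∀ ι : Type v, PreservesColimitsOfShape (Discrete ι) F) →
        (∀ i, IsZero (F.obj (G i))) → ∀ {K : T}, compactObjects T K →
        ∀ f : K ⟶ F.obj Z, f = 0) := by
  obtain ⟨X, rfl, hX⟩ := exists_isTower G X₀
  obtain ⟨L, ⟨t⟩⟩ := Telescope.exists_telescope X
  obtain ⟨Z, v, w, h⟩ := distinguished_cocone_triangle (t.incl 0)
  refine ⟨L, Z, t.incl 0, v, w, h, fun i g => ?_, fun P _ _ hP hGP K hK g hg => ?_,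
    fun F _ _ hF hGF K hK f => ?_⟩
  · obtain ⟨n, k, rfl⟩ := t.exists_eq_comp_incl (hG i) g
    rw [← t.map_succ_incl, ← assoc, hX.comp_map, zero_comp]
  · obtain ⟨m, hm, h0⟩ := t.exists_map_eq_zero hK g hg
    exact hX.exists_trW hP hGP hm hK g h0
  · have h' := F.map_distinguished _ h
    have e : F.map (t.incl 0) = (t.map F).incl 0 := F.map_comp _ _
    rw [Functor.mapTriangle_obj] at h'
    exact (t.map F).eq_zero_of_isIso (hX.isIso_map F hF hGF) (e ▸ h') hK f

end Tower

/-! ### Essential smallness of the compact objects -/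

section EssentiallySmall

/-- An extension is determined up to isomorphism by its connecting morphism, and small skeleta have
only a small set of these. -/
instance (P Q : ObjectProperty T) [ObjectProperty.EssentiallySmall.{v} P]
    [ObjectProperty.EssentiallySmall.{v} Q] :
    ObjectProperty.EssentiallySmall.{v} (P.extensionProduct Q) := by
  obtain ⟨P', hP', -, hP⟩ := ObjectProperty.EssentiallySmall.exists_small_le.{v} P
  obtain ⟨Q', hQ', -, hQ⟩ := ObjectProperty.EssentiallySmall.exists_small_le.{v} Q
  have : ObjectProperty.EssentiallySmall.{v} (P'.extensionProduct Q') := by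
    choose f a b h using fun p : Σ (A : Subtype P') (B : Subtype Q'), (B.1 ⟶ A.1⟦(1 : ℤ)⟧) =>
      distinguished_cocone_triangle₂ p.2.2
    refine ⟨ObjectProperty.ofObj f, inferInstance, ?_⟩
    rintro X ⟨A, B, a', b', c, hT, hA, hB⟩
    let p : Σ (A : Subtype P') (B : Subtype Q'), (B.1 ⟶ A.1⟦(1 : ℤ)⟧) := ⟨⟨A, hA⟩, ⟨B, hB⟩, c⟩
    exact ⟨f p, ⟨p⟩, ⟨Triangle.π₂.mapIso (isoTriangleOfIso₁₃ _ _ hT (h p) (Iso.refl A) (Iso.refl B)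
      ((congrArg (c ≫ ·) ((shiftFunctor T (1 : ℤ)).map_id A)).trans
        ((comp_id c).trans (id_comp c).symm)))⟩⟩
  refine .of_le (Q := P'.extensionProduct Q') ?_
  rw [← P'.extensionProduct_isoClosure_left, ← P'.isoClosure.extensionProduct_isoClosure_right]
  exact (ObjectProperty.monotone_extensionProduct_left _ hP).trans
    (ObjectProperty.monotone_extensionProduct_right _ hQ)

instance (P : ObjectProperty T) [ObjectProperty.EssentiallySmall.{v} P] :
    ObjectProperty.EssentiallySmall.{v} (P.shiftClosure ℤ) := by
  obtain ⟨Q, hQ, -, hP⟩ := ObjectProperty.EssentiallySmall.exists_small_le.{v} P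
  refine ⟨ObjectProperty.ofObj fun p : Subtype Q × ℤ => p.1.1⟦p.2⟧, inferInstance, ?_⟩
  rintro X ⟨Y, n, e, hY⟩
  obtain ⟨Z, hZ, ⟨e'⟩⟩ := hP _ hY
  exact ⟨_, ⟨⟨⟨Z, hZ⟩, n⟩⟩, ⟨e ≪≫ (shiftFunctor T n).mapIso e'⟩⟩

instance (P : ObjectProperty T) [ObjectProperty.EssentiallySmall.{v} P] (n : ℕ) :
    ObjectProperty.EssentiallySmall.{v} (P.extensionProductIter n) := by
  induction n with
  | zero => assumption
  | succ n ih =>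
    rw [ObjectProperty.extensionProductIter_succ]
    infer_instance

instance (P : ObjectProperty T) [ObjectProperty.EssentiallySmall.{v} P] :
    ObjectProperty.EssentiallySmall.{v} P.triangEnvelope := by
  have : ObjectProperty.EssentiallySmall.{v} (P.shiftClosure ℤ).binaryProductsClosure :=
    inferInstanceAs (ObjectProperty.EssentiallySmall.{v} (ObjectProperty.limitsClosure _ _))
  unfold ObjectProperty.triangEnvelope
  infer_instance

end EssentiallySmall

/-- When the first map of a triangle is zero, the second is a split monomorphism. -/
lemma prop_of_trW_zero {P : ObjectProperty T} [P.IsTriangulated] [P.IsStableUnderRetracts]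
    {K' K : T} (h : P.trW (0 : K' ⟶ K)) : P K := by
  obtain ⟨D, a, b, hT, hD⟩ := h
  obtain ⟨r, hr⟩ := exists_desc₂ hT (f := 𝟙 K) zero_comp
  exact P.prop_of_retract ⟨a, r, hr.symm⟩ hD

section Shift

variable {T : Type u} [Category.{v} T] [Preadditive T] [HasShift T ℤ]
  [∀ n : ℤ, (shiftFunctor T n).Additive]

lemma isZero_of_forall_shift {G Y : T} (h : ∀ (n : ℤ) (f : G⟦n⟧ ⟶ Y), f = 0) (n : ℤ)
    (f : G ⟶ Y⟦n⟧) : f = 0 := by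
  apply (shiftFunctor T (-n)).map_injective
  let e : (Y⟦n⟧)⟦-n⟧ ≅ Y := ((shiftEquiv T n).unitIso.app Y).symm
  rw [Functor.map_zero]
  exact zero_of_comp_mono e.hom (h (-n) (f⟦-n⟧' ≫ e.hom))

end Shift

section Generators

variable [MonoidalCategory T] [HasCoproducts.{v} T] [CompactlyGenerated T]

/-- An object which receives no nonzero morphisms from compact objects is zero. -/
lemma isZero_of_forall_compact {Y : T} (h : ∀ K, compactObjects T K → ∀ f : K ⟶ Y, f = 0) :
    IsZero Y := by
  obtain ⟨ι, G, hG, hY⟩ := CompactlyGenerated.exists_generators (T := T)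
  exact hY Y fun i => isZero_of_forall_shift fun n =>
    h _ ((compactObjects T).le_shift n _ (hG i))

/-- There is a set of representatives for the isomorphism classes of compact objects. -/
instance compactObjects_essentiallySmall [IsTriangulated T] :
    ObjectProperty.EssentiallySmall.{v} (compactObjects T) := by
  obtain ⟨ι, G, hG, hY⟩ := CompactlyGenerated.exists_generators (T := T)
  -- The added zero object keeps the family nonempty.
  let P : ObjectProperty T := ObjectProperty.ofObj fun i : Option ι => i.elim 0 G
  have hP : P.Nonempty := ⟨_, ⟨none⟩⟩
  have h : P.triangEnvelope ≤ compactObjects T := by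
    rw [ObjectProperty.triangEnvelope_le_iff]
    rintro _ ⟨_ | i⟩
    · exact (compactObjects T).prop_zero
    · exact hG i
  refine .of_le (Q := P.triangEnvelope) fun K hK => ?_
  have hPG : ∀ p : ι × ℤ, P.triangEnvelope ((G p.1)⟦p.2⟧) := fun p =>
    P.triangEnvelope.le_shift _ _ (P.le_triangEnvelope _ ⟨some p.1⟩)
  -- Coning off all shifts of the generators forces `L = 0`. So `𝟙 K` dies in `L`, and `K` is a
  -- retract of an object of the envelope.
  obtain ⟨L, Z, u, v, w, hT, h₁, h₂, -⟩ := exists_localization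
    (fun p : ι × ℤ => (G p.1)⟦p.2⟧) (fun p => h _ (hPG p)) K
  have hL : IsZero L := hY L fun i => isZero_of_forall_shift fun n f => h₁ (i, n) f
  obtain ⟨K', s, hs, h0⟩ := h₂ _ h hPG hK (𝟙 K) (hL.eq_of_tgt _ _)
  rw [comp_id] at h0
  exact prop_of_trW_zero (h0 ▸ hs)

end Generators

end TensorTriangulated

namespace TensorTriangulated

/-! ### Duality and tensor ideals -/

section Monoidal

variable {T : Type u} [Category.{v} T] [MonoidalCategory T]

/-- An object with a right dual `Y` is a retract of `X ⊗ Y ⊗ X`. -/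
def retractOfExactPairing (X Y : T) [ExactPairing X Y] : Retract X (X ⊗ Y ⊗ X) where
  i := (λ_ X).inv ≫ η_ X Y ▷ X ≫ (α_ X Y X).hom
  r := X ◁ ε_ X Y ≫ (ρ_ X).hom
  retract := by
    have := ExactPairing.evaluation_coevaluation X Y
    simp only [assoc]
    rw [reassoc_of% this]
    simp

/-- A right dual `Y` of `X` is a retract of `(Y ⊗ X) ⊗ Y`. -/
def retractOfExactPairing' (X Y : T) [ExactPairing X Y] : Retract Y ((Y ⊗ X) ⊗ Y) where
  i := (ρ_ Y).inv ≫ Y ◁ η_ X Y ≫ (α_ Y X Y).inv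
  r := ε_ X Y ▷ Y ≫ (λ_ Y).hom
  retract := by
    have := ExactPairing.coevaluation_evaluation X Y
    simp only [assoc]
    rw [reassoc_of% this]
    simp

lemma isZero_tensor_assoc {X Y Z : T} : IsZero ((X ⊗ Y) ⊗ Z) ↔ IsZero (X ⊗ Y ⊗ Z) :=
  (α_ X Y Z).isZero_iff

lemma eq_zero_of_isZero_tensor [Preadditive T] {X D K L : T} [ExactPairing D X]
    (h : IsZero (D ⊗ L)) (f : X ⊗ K ⟶ L) : f = 0 :=
  (tensorLeftHomEquiv K D X L).injective (h.eq_of_tgt _ _)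

variable [SymmetricCategory T]

lemma isZero_tensor_comm {X Y : T} : IsZero (X ⊗ Y) ↔ IsZero (Y ⊗ X) :=
  (β_ X Y).isZero_iff

/-- The isomorphism exchanging the first two factors of a triple tensor product. -/
def tensorLeftComm (X Y Z : T) : X ⊗ Y ⊗ Z ≅ Y ⊗ X ⊗ Z :=
  (α_ X Y Z).symm ≪≫ whiskerRightIso (β_ X Y) Z ≪≫ α_ Y X Z

end Monoidal

variable {T : Type u} [Category.{v} T] [HasZeroObject T] [HasShift T ℤ] [Preadditive T]
  [∀ n : ℤ, (shiftFunctor T n).Additive] [Pretriangulated T]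
  [MonoidalCategory T] [HasCoproducts.{v} T] [CompactlyGenerated T]

instance (X : T) : (tensorLeft X).Additive := by
  obtain ⟨_, _⟩ := CompactlyGenerated.exact_tensorLeft X
  infer_instance

lemma isZero_tensor_right (X : T) {Y : T} (h : IsZero Y) : IsZero (X ⊗ Y) :=
  (tensorLeft X).map_isZero h

/-- Tensoring a compact object with the dual of an object yields a compact object. -/
lemma compactObjects_tensor_of_exactPairing (X D Y : T) [ExactPairing D X]
    (hY : compactObjects T Y) : compactObjects T (X ⊗ Y) := by
  intro ι Z f
  have _ := CompactlyGenerated.preservesCoproducts_tensorLeft D ι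
  obtain ⟨s, g, hg⟩ := hY.exists_eq_sum (isColimitCofanMkObjOfIsColimit (tensorLeft D) _ _
    (coproductIsCoproduct Z)) (tensorLeftHomEquiv _ D X _ f)
  refine ⟨s, fun i => (tensorLeftHomEquiv _ D X _).symm (g i), ?_⟩
  have hw : ∀ {B : T} (k : ι → (X ⊗ Y ⟶ B)),
      tensorLeftHomEquiv _ D X _ (∑ i ∈ s, k i) = ∑ i ∈ s, tensorLeftHomEquiv _ D X _ (k i) := by
    intro B k
    have : D ◁ (∑ i ∈ s, k i) = ∑ i ∈ s, D ◁ k i := (tensorLeft D).map_sum k s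
    simp [tensorLeftHomEquiv, this, Preadditive.comp_sum]
  apply (tensorLeftHomEquiv _ D X _).injective
  rw [hg, hw]
  refine Finset.sum_congr rfl fun i _ => ?_
  rw [tensorLeftHomEquiv_naturality, Equiv.apply_symm_apply]
  rfl

/-- By adjunction, maps out of `X` are maps from the compact unit into `D ⊗ -`. In particular duals
of compact objects are compact. -/
lemma compactObjects_of_exactPairing (X D : T) [ExactPairing D X] : compactObjects T X :=
  (compactObjects T).prop_of_iso (ρ_ X)
    (compactObjects_tensor_of_exactPairing X D (𝟙_ T) CompactlyGenerated.compact_unit)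

lemma isZero_tensor_of_forall {X D L : T} [ExactPairing D X]
    (h : ∀ K, compactObjects T K → ∀ f : X ⊗ K ⟶ L, f = 0) : IsZero (D ⊗ L) :=
  isZero_of_forall_compact fun K hK _ => (tensorLeftHomEquiv K D X L).symm.injective
    ((h K hK _).trans (h K hK _).symm)

variable [SymmetricCategory T]

lemma isZero_tensor_left {X : T} (Y : T) (h : IsZero X) : IsZero (X ⊗ Y) :=
  isZero_tensor_comm.1 (isZero_tensor_right Y h)

namespace ThickTensorIdeal

instance (C : ThickTensorIdeal T) : C.prop.IsTriangulated := C.triangulated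

instance (C : ThickTensorIdeal T) : C.prop.IsStableUnderRetracts := C.thick

variable {C D : ThickTensorIdeal T}

omit [CompactlyGenerated T] in
lemma tensor_mem_right {X Y : T} (hX : compactObjects T X) (hY : C.prop Y) : C.prop (X ⊗ Y) :=
  C.prop.prop_of_iso (β_ Y X) (C.tensor_mem Y X hY hX)

lemma mem_of_exactPairing {X Y : T} [ExactPairing X Y] (hX : C.prop X) : C.prop Y := by
  have hY := compactObjects_of_exactPairing Y X
  exact C.prop.prop_of_retract (retractOfExactPairing' X Y)
    (C.tensor_mem _ _ (tensor_mem_right hY hX) hY)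

/-- Ideals are radical because `X` is a retract of `X ⊗ Y ⊗ X ≅ Y ⊗ X ⊗ X`. -/
lemma mem_of_tensor_self_mem {X : T} (hX : compactObjects T X) (h : C.prop (X ⊗ X)) :
    C.prop X := by
  obtain ⟨Y, ⟨_⟩⟩ := CompactlyGenerated.dualizable X hX
  have hY := compactObjects_of_exactPairing Y X
  exact C.prop.prop_of_retract (retractOfExactPairing X Y)
    (C.prop.prop_of_iso (tensorLeftComm Y X X) (tensor_mem_right hY h))

/-- The right orthogonal of an ideal with respect to the tensor product. -/
def annihilator (C : ThickTensorIdeal T) : ObjectProperty T :=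
  fun Y => ∀ X, C.prop X → IsZero (X ⊗ Y)

variable (C)

/-- The idempotent triangle `Γ ⟶ 𝟙 ⟶ L` associated with an ideal of compact objects. -/
theorem exists_idempotent_triangle [IsTriangulated T] :
    ∃ Γ L : T, (∀ W, IsZero (W ⊗ Γ) → Nonempty (W ≅ W ⊗ L)) ∧
      (∀ W, IsZero (W ⊗ L) → Nonempty (W ≅ W ⊗ Γ)) ∧
      C.annihilator L ∧ (∀ Y, C.annihilator Y → IsZero (Γ ⊗ Y)) ∧
      (∀ X, compactObjects T X → IsZero (X ⊗ L) → C.prop X) := by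
  have : ObjectProperty.EssentiallySmall.{v} C.prop := .of_le C.le_compact
  obtain ⟨Q, hQ, hQC, hCQ⟩ := ObjectProperty.EssentiallySmall.exists_small_le.{v} C.prop
  let G (i : Shrink.{v} (Subtype Q)) : T := ((equivShrink _).symm i).1
  have hG : ∀ i, C.prop (G i) := fun i => hQC _ ((equivShrink _).symm i).2
  obtain ⟨L, Z, u, v, w, h, h₁, h₂, h₃⟩ :=
    exists_localization G (fun i => C.le_compact _ (hG i)) (𝟙_ T)
  obtain ⟨Γ, a, b, h'⟩ := distinguished_cocone_triangle₁ u
  have hΓ : ∀ W : T, IsZero (W ⊗ Γ) ↔ IsIso (W ◁ u) := fun W => by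
    obtain ⟨_, _⟩ := CompactlyGenerated.exact_tensorLeft W
    exact Triangle.isZero₁_iff_isIso₂ _ ((tensorLeft W).map_distinguished _ h')
  have hL : ∀ W : T, IsZero (W ⊗ L) ↔ IsIso (W ◁ a) := fun W => by
    obtain ⟨_, _⟩ := CompactlyGenerated.exact_tensorLeft W
    exact Triangle.isZero₃_iff_isIso₁ _ ((tensorLeft W).map_distinguished _ h')
  have hom : ∀ X, C.prop X → ∀ f : X ⟶ L, f = 0 := fun X hX f => by
    obtain ⟨Y, hY, ⟨e⟩⟩ := hCQ X hX
    have := h₁ (equivShrink _ ⟨Y, hY⟩) (eqToHom (by simp [G]) ≫ e.inv ≫ f)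
    simpa using this
  refine ⟨Γ, L, fun W hW => ?_, fun W hW => ?_, fun X hX => ?_, fun Y hY => ?_, fun X hX hXL => ?_⟩
  · have := (hΓ W).1 hW
    exact ⟨(ρ_ W).symm ≪≫ asIso (W ◁ u)⟩
  · have := (hL W).1 hW
    exact ⟨(ρ_ W).symm ≪≫ (asIso (W ◁ a)).symm⟩
  -- Maps `K ⟶ X ⊗ L` correspond to maps `Y ⊗ K ⟶ L`, whose source lies in `C`.
  · obtain ⟨Y, ⟨_⟩⟩ := CompactlyGenerated.dualizable X (C.le_compact _ hX)
    exact isZero_tensor_of_forall (X := Y) fun K hK f =>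
      hom _ (C.tensor_mem _ _ (mem_of_exactPairing hX) hK) f
  -- Tensoring with `Y` turns every transition map of the tower into an isomorphism, so it kills the
  -- cone `Z` of `u`.
  · rw [isZero_tensor_comm, hΓ]
    obtain ⟨_, _⟩ := CompactlyGenerated.exact_tensorLeft Y
    exact (Triangle.isZero₃_iff_isIso₁ _ ((tensorLeft Y).map_distinguished _ h)).1
      (isZero_of_forall_compact fun K hK f => h₃ (tensorLeft Y)
        (CompactlyGenerated.preservesCoproducts_tensorLeft Y)
        (fun i => isZero_tensor_comm.1 (hY _ (hG i))) hK f)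
  · obtain ⟨Y, ⟨_⟩⟩ := CompactlyGenerated.dualizable X hX
    -- The evaluation vanishes in `L`, since maps `Y ⊗ X ⟶ L` correspond to maps `X ⟶ X ⊗ L = 0`. It
    -- therefore factors through the cone `c` of `s`, which lies in `C`.
    obtain ⟨K, s, ⟨c, k, l, hc, hcC⟩, hs⟩ := h₂ C.prop C.le_compact hG
      (compactObjects_tensor_of_exactPairing Y X X hX) (ε_ X Y) (eq_zero_of_isZero_tensor hXL _)
    obtain ⟨m, hm⟩ := exists_desc₂ hc hs
    let r := retractOfExactPairing X Y
    refine C.prop.prop_of_retract (Y := X ⊗ c) ⟨r.i ≫ X ◁ k, X ◁ m ≫ (ρ_ X).hom, ?_⟩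
      (tensor_mem_right hX hcC)
    rw [assoc, ← whiskerLeft_comp_assoc, ← hm]
    exact r.retract

end ThickTensorIdeal

end TensorTriangulated

namespace TensorTriangulated

section Zero

variable {T : Type u} [Category.{v} T] [HasZeroObject T] [HasShift T ℤ] [Preadditive T]
  [∀ n : ℤ, (shiftFunctor T n).Additive] [Pretriangulated T]

instance isZero_isTriangulated : ObjectProperty.IsTriangulated (IsZero : ObjectProperty T) where
  exists_zero := ⟨0, isZero_zero T, isZero_zero T⟩
  isStableUnderShiftBy n := ⟨fun _ h => (shiftFunctor T n).map_isZero h⟩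
  ext₂' D hD h₁ h₃ := ObjectProperty.le_isoClosure _ _ (D.isZero₂_of_isZero₁₃ hD h₁ h₃)

instance isZero_isStableUnderRetracts :
    ObjectProperty.IsStableUnderRetracts (IsZero : ObjectProperty T) where
  of_retract r h := by
    rw [IsZero.iff_id_eq_zero, ← r.retract, h.eq_of_tgt r.i 0, zero_comp]

end Zero

variable {T : Type u} [Category.{v} T] [HasZeroObject T] [HasShift T ℤ] [Preadditive T]
  [∀ n : ℤ, (shiftFunctor T n).Additive] [Pretriangulated T]
  [MonoidalCategory T] [SymmetricCategory T] [HasCoproducts.{v} T] [CompactlyGenerated T]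

/-! ### The frame of tensor ideals -/

namespace ThickTensorIdeal

variable {C D : ThickTensorIdeal T}

/-- The ideal of the compact objects `X` such that `Z ⊗ X` belongs to `P` for all `Z` in `Q`. -/
def residual (P : ObjectProperty T) [P.IsTriangulated] [P.IsStableUnderRetracts]
    (hP : ∀ X Y, P X → compactObjects T Y → P (X ⊗ Y)) (Q : ObjectProperty T) :
    ThickTensorIdeal T where
  prop X := compactObjects T X ∧ ∀ Z, Q Z → P (Z ⊗ X)
  le_compact _ h := h.1
  triangulated :=
    { exists_zero := ⟨0, isZero_zero T, (compactObjects T).prop_zero, fun Z _ =>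
        P.prop_of_isZero (isZero_tensor_right Z (isZero_zero T))⟩
      isStableUnderShiftBy n := ⟨fun X hX => ⟨(compactObjects T).le_shift n X hX.1, fun Z hZ => by
        obtain ⟨_, _⟩ := CompactlyGenerated.exact_tensorLeft Z
        exact (P.inverseImage (tensorLeft Z)).le_shift n X (hX.2 Z hZ)⟩⟩
      ext₂' D hD h₁ h₃ := ObjectProperty.le_isoClosure _ _
        ⟨(compactObjects T).ext_of_isTriangulatedClosed₂ D hD h₁.1 h₃.1, fun Z hZ => by
          obtain ⟨_, _⟩ := CompactlyGenerated.exact_tensorLeft Z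
          exact (P.inverseImage (tensorLeft Z)).ext_of_isTriangulatedClosed₂ D hD (h₁.2 Z hZ)
            (h₃.2 Z hZ)⟩ }
  thick := ⟨fun r h => ⟨(compactObjects T).prop_of_retract r h.1, fun Z hZ =>
    P.prop_of_retract (r.map (tensorLeft Z)) (h.2 Z hZ)⟩⟩
  tensor_mem X Y hX hY := ⟨compactObjects_tensor T X Y hX.1 hY, fun Z hZ =>
    P.prop_of_iso (α_ Z X Y) (hP _ _ (hX.2 Z hZ) hY)⟩

/-- The ideal of the compact objects `X` such that `Z ⊗ X` belongs to `C` for all `Z` in `Q`. -/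
def quotient (C : ThickTensorIdeal T) (Q : ObjectProperty T) : ThickTensorIdeal T :=
  residual C.prop C.tensor_mem Q

/-- The ideal of the compact objects annihilated by `Y`. -/
def annihilatorOf (Y : T) : ThickTensorIdeal T :=
  residual IsZero (fun _ Y h _ => isZero_tensor_left Y h) (fun Z => Z = Y)

lemma annihilatorOf_prop {Y X : T} (hX : compactObjects T X) :
    (annihilatorOf Y).prop X ↔ IsZero (X ⊗ Y) := by
  rw [isZero_tensor_comm]
  exact ⟨fun h => h.2 Y rfl, fun h => ⟨hX, by rintro _ rfl; exact h⟩⟩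

lemma inf_prop {X : T} : (C ⊓ D).prop X ↔ C.prop X ∧ D.prop X := by
  refine ⟨fun h => ⟨(inf_le_left : C ⊓ D ≤ C) X h, (inf_le_right : C ⊓ D ≤ D) X h⟩, fun h => ?_⟩
  have : sInf {C, D} ≤ C ⊓ D := le_inf (sInf_le (by simp)) (sInf_le (by simp))
  exact this X ⟨C.le_compact X h.1, by rintro E (rfl | rfl); exacts [h.1, h.2]⟩

/-- The ideal generated by a class of compact objects. -/
def generate (P : ObjectProperty T) : ThickTensorIdeal T := sInf {C | P ≤ C.prop}

lemma le_generate {P : ObjectProperty T} (hP : P ≤ compactObjects T) : P ≤ (generate P).prop :=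
  fun X hX => ⟨hP X hX, fun _ hC => hC X hX⟩

lemma generate_le_iff {P : ObjectProperty T} (hP : P ≤ compactObjects T) :
    generate P ≤ C ↔ P ≤ C.prop :=
  ⟨fun h => (le_generate hP).trans h, fun h => sInf_le h⟩

lemma generate_prop (C : ThickTensorIdeal T) : generate C.prop = C :=
  le_antisymm ((generate_le_iff C.le_compact).2 le_rfl) (le_generate C.le_compact)

/-- The ideal generated by an object. -/
def principal (X : T) : ThickTensorIdeal T := generate (ObjectProperty.singleton X)

lemma principal_le_iff {X : T} (hX : compactObjects T X) : principal X ≤ C ↔ C.prop X :=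
  (generate_le_iff (by simpa using hX)).trans (by simp)

lemma mem_principal {X : T} (hX : compactObjects T X) : (principal X).prop X :=
  (principal_le_iff hX).1 le_rfl

/-- The union of a directed family of ideals. -/
def directedUnion (S : Set (ThickTensorIdeal T)) (hS : S.Nonempty) (h : DirectedOn (· ≤ ·) S) :
    ThickTensorIdeal T where
  prop X := ∃ C ∈ S, C.prop X
  le_compact := by
    rintro X ⟨C, -, hX⟩
    exact C.le_compact X hX
  triangulated :=
    { exists_zero := ⟨0, isZero_zero T, hS.some, hS.some_mem, hS.some.prop.prop_zero⟩
      isStableUnderShiftBy n := ⟨fun X hX => by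
        obtain ⟨C, hC, hX⟩ := hX
        exact ⟨C, hC, C.prop.le_shift n X hX⟩⟩
      ext₂' := by
        rintro D hD ⟨C, hC, h₁⟩ ⟨C', hC', h₃⟩
        obtain ⟨E, hE, hCE, hCE'⟩ := h C hC C' hC'
        exact ObjectProperty.le_isoClosure _ _ ⟨E, hE,
          E.prop.ext_of_isTriangulatedClosed₂ D hD (hCE _ h₁) (hCE' _ h₃)⟩ }
  thick := ⟨by
    rintro X Y r ⟨C, hC, hX⟩
    exact ⟨C, hC, C.prop.prop_of_retract r hX⟩⟩
  tensor_mem := by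
    rintro X Y ⟨C, hC, hX⟩ hY
    exact ⟨C, hC, C.tensor_mem X Y hX hY⟩

lemma exists_mem_of_mem_sSup {S : Set (ThickTensorIdeal T)} (hS : S.Nonempty)
    (h : DirectedOn (· ≤ ·) S) {X : T} (hX : (sSup S).prop X) : ∃ C ∈ S, C.prop X := by
  have : sSup S ≤ directedUnion S hS h := sSup_le fun C hC X hX => ⟨C, hC, hX⟩
  exact this X hX

lemma isCompactElement_principal {X : T} (hX : compactObjects T X) :
    IsCompactElement (principal X) := by
  rw [CompleteLattice.isCompactElement_iff_le_of_directed_sSup_le]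
  intro S hS h hle
  obtain ⟨C, hC, hCX⟩ := exists_mem_of_mem_sSup hS h (hle X (mem_principal hX))
  exact ⟨C, hC, (principal_le_iff hX).2 hCX⟩

lemma sSup_principal (C : ThickTensorIdeal T) : sSup (principal '' {X | C.prop X}) = C := by
  refine le_antisymm (sSup_le ?_) fun X hX => ?_
  · rintro _ ⟨X, hX, rfl⟩
    exact (principal_le_iff (C.le_compact X hX)).2 hX
  · exact (principal_le_iff (C.le_compact X hX)).1 (le_sSup ⟨X, hX, rfl⟩)

lemma isCompactElement_iff : IsCompactElement C ↔ ∃ X, compactObjects T X ∧ C = principal X := by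
  refine ⟨fun h => ?_, by rintro ⟨X, hX, rfl⟩; exact isCompactElement_principal hX⟩
  rw [CompleteLattice.isCompactElement_iff_le_of_directed_sSup_le] at h
  obtain ⟨_, ⟨X, hX, rfl⟩, hCX⟩ := h (principal '' {X | C.prop X})
    ⟨_, 0, C.prop.prop_zero, rfl⟩ (by
      rintro _ ⟨X, hX, rfl⟩ _ ⟨Y, hY, rfl⟩
      have hXY : C.prop (X ⊞ Y) := C.prop.ext_of_isTriangulatedClosed₂ _
        (binaryBiproductTriangle_distinguished X Y) hX hY
      have h := mem_principal (C.le_compact _ hXY)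
      refine ⟨_, ⟨X ⊞ Y, hXY, rfl⟩, (principal_le_iff (C.le_compact X hX)).2 ?_,
        (principal_le_iff (C.le_compact Y hY)).2 ?_⟩
      · exact ObjectProperty.prop_of_retract _ ⟨biprod.inl, biprod.fst, biprod.inl_fst⟩ h
      · exact ObjectProperty.prop_of_retract _ ⟨biprod.inr, biprod.snd, biprod.inr_snd⟩ h)
    (sSup_principal C).ge
  exact ⟨X, C.le_compact X hX, le_antisymm hCX ((principal_le_iff (C.le_compact X hX)).2 hX)⟩

/-- Two quotient ideals show that `A ⊗ B` lies in the ideal of `X ⊗ Y` for `A` in that of `X` and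
`B` in that of `Y`; take `A = B = Z` and use radicality. -/
lemma principal_inf_principal {X Y : T} (hX : compactObjects T X) (hY : compactObjects T Y) :
    principal X ⊓ principal Y = principal (X ⊗ Y) := by
  have hXY := compactObjects_tensor T X Y hX hY
  refine le_antisymm (fun Z hZ => ?_) ((principal_le_iff hXY).2 (inf_prop.2
    ⟨tensor_mem _ _ _ (mem_principal hX) hY, tensor_mem_right hX (mem_principal hY)⟩))
  obtain ⟨hZX, hZY⟩ := inf_prop.1 hZ
  have h₁ : principal X ≤ quotient (principal (X ⊗ Y)) (ObjectProperty.singleton Y) :=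
    (principal_le_iff hX).2 ⟨hX, by
      rintro _ ⟨⟩
      exact (principal (X ⊗ Y)).prop.prop_of_iso (β_ X Y) (mem_principal hXY)⟩
  have h₂ : principal Y ≤ quotient (principal (X ⊗ Y)) (principal X).prop :=
    (principal_le_iff hY).2 ⟨hY, fun A hA =>
      (principal (X ⊗ Y)).prop.prop_of_iso (β_ Y A) ((h₁ A hA).2 Y (by simp))⟩
  exact mem_of_tensor_self_mem ((principal X).le_compact Z hZX) ((h₂ Z hZY).2 Z hZX)

/-- The quotient of the right-hand side by `C` contains each member of `S`, hence `sSup S`; so `X ⊗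
X` lies in the right-hand side, which is radical. -/
lemma inf_sSup_le (C : ThickTensorIdeal T) (S : Set (ThickTensorIdeal T)) :
    C ⊓ sSup S ≤ ⨆ D ∈ S, C ⊓ D := by
  intro X hX
  obtain ⟨hXC, hXS⟩ := inf_prop.1 hX
  have : sSup S ≤ quotient (⨆ D ∈ S, C ⊓ D) C.prop := sSup_le fun D hD Y hY =>
    ⟨D.le_compact Y hY, fun Z hZ => (le_iSup₂_of_le D hD le_rfl : C ⊓ D ≤ ⨆ D ∈ S, C ⊓ D) _
      (inf_prop.2 ⟨C.tensor_mem Z Y hZ (D.le_compact Y hY),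
        tensor_mem_right (C.le_compact Z hZ) hY⟩)⟩
  exact mem_of_tensor_self_mem (C.le_compact X hXC) ((this X hXS).2 X hXC)

lemma top_eq_principal : (⊤ : ThickTensorIdeal T) = principal (𝟙_ T) :=
  (top_le_iff.1 fun X hX => (principal _).prop.prop_of_iso (λ_ X)
    (tensor_mem _ _ _ (mem_principal CompactlyGenerated.compact_unit)
      ((⊤ : ThickTensorIdeal T).le_compact X hX))).symm

variable (T) in
theorem isCoherentFrame : IsCoherentFrame (ThickTensorIdeal T) where
  inf_sSup_eq C S := le_antisymm (inf_sSup_le C S)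
    (iSup₂_le fun _ hD => inf_le_inf_left _ (le_sSup hD))
  compactlyGenerated C := ⟨_, by
    rintro _ ⟨X, hX, rfl⟩
    exact isCompactElement_principal (C.le_compact X hX), sSup_principal C⟩
  compact_top := isCompactElement_iff.2 ⟨_, CompactlyGenerated.compact_unit, top_eq_principal⟩
  compact_sup C D hC hD := by
    classical
    have := CompleteLattice.isCompactElement_finsetSup (s := {C, D}) (f := id)
      (by simpa using ⟨hC, hD⟩)
    simpa using this
  compact_inf C D hC hD := by
    obtain ⟨X, hX, rfl⟩ := isCompactElement_iff.1 hC
    obtain ⟨Y, hY, rfl⟩ := isCompactElement_iff.1 hD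
    exact isCompactElement_iff.2 ⟨_, compactObjects_tensor T X Y hX hY,
      principal_inf_principal hX hY⟩

/-! ### The embedding into the Bousfield lattice -/

variable [IsTriangulated T]

/-- The common annihilator of the objects of an ideal is a Bousfield class. -/
lemma exists_annihilator_eq (C : ThickTensorIdeal T) :
    ∃ Γ : T, C.annihilator = acyclics Γ ∧ acyclics Γ = acyclics (Γ ⊗ Γ) := by
  obtain ⟨Γ, L, h₁, h₂, h₃, h₄, -⟩ := C.exists_idempotent_triangle
  have h : C.annihilator = acyclics Γ := by
    ext Y
    refine ⟨fun hY => h₄ Y hY, fun hY X hX => ?_⟩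
    obtain ⟨e⟩ := h₁ Y (isZero_tensor_comm.1 hY)
    exact (isZero_tensor_right Y (h₃ X hX)).of_iso (whiskerLeftIso X e ≪≫ tensorLeftComm X Y L)
  refine ⟨Γ, h, ?_⟩
  ext Y
  refine ⟨fun hY => isZero_tensor_assoc.2 (isZero_tensor_right Γ hY), fun hY => ?_⟩
  -- From `Γ ⊗ Γ ⊗ Y = 0`, the ideal kills `Γ ⊗ Y`; one factor `Γ` is then absorbed by `X ≅ X ⊗ Γ`.
  have hY' : C.annihilator (Γ ⊗ Y) := h ▸ isZero_tensor_assoc.1 hY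
  rw [← h]
  intro X hX
  obtain ⟨e⟩ := h₂ X (h₃ X hX)
  exact (hY' X hX).of_iso (whiskerRightIso e Y ≪≫ α_ X Γ Y)

/-- The Bousfield class associated with an ideal of compact objects. -/
def toBousfield (C : ThickTensorIdeal T) : BousfieldLattice T where
  prop := C.annihilator
  exists_eq := C.exists_annihilator_eq.imp fun _ h => h.1

lemma toBousfield_mem_bousfieldIdempotents (C : ThickTensorIdeal T) :
    C.toBousfield ∈ bousfieldIdempotents T := by
  obtain ⟨Γ, h, h'⟩ := C.exists_annihilator_eq
  exact ⟨Γ, BousfieldLattice.ext h, BousfieldLattice.ext h'⟩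

/-- The test object is the `L` of `D`: it is killed by `D`, and every compact object killing it lies
in `D`. -/
lemma le_iff_annihilator_le : C ≤ D ↔ D.annihilator ≤ C.annihilator := by
  refine ⟨fun h _ hY X hX => hY X (h X hX), fun h X hX => ?_⟩
  obtain ⟨Γ, L, -, -, h₃, -, h₅⟩ := D.exists_idempotent_triangle
  exact h₅ X (C.le_compact X hX) (h L h₃ X hX)

variable (T) in
/-- The embedding of the lattice of ideals of compact objects into the Bousfield lattice. -/
def bousfieldEmbedding : ThickTensorIdeal T ↪o BousfieldLattice T :=
  OrderEmbedding.ofMapLEIff toBousfield fun _ _ => le_iff_annihilator_le.symm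

/-- The compact objects killed by `Y` form an ideal, so `Y` is killed by `P` exactly when it is
killed by the ideal generated. -/
lemma isLUB_bousfieldEmbedding_generate {P : ObjectProperty T} (hP : P ≤ compactObjects T) :
    IsLUB (bousfieldClass '' {X | P X}) (bousfieldEmbedding T (generate P)) := by
  refine ⟨?_, fun a ha Y hY => ?_⟩
  · rintro _ ⟨X, hX, rfl⟩ Y hY
    exact hY X (le_generate hP X hX)
  · have : generate P ≤ annihilatorOf Y := (generate_le_iff hP).2 fun X hX =>
      (annihilatorOf_prop (hP X hX)).2 (ha ⟨X, hX, rfl⟩ Y hY)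
    exact fun X hX => (annihilatorOf_prop ((generate P).le_compact X hX)).1 (this X hX)

lemma isLUB_bousfieldEmbedding (C : ThickTensorIdeal T) :
    IsLUB (bousfieldClass '' {X | C.prop X}) (bousfieldEmbedding T C) := by
  simpa only [generate_prop] using isLUB_bousfieldEmbedding_generate C.le_compact

lemma isLUB_bousfieldEmbedding_sSup (S : Set (ThickTensorIdeal T)) :
    IsLUB (bousfieldEmbedding T '' S) (bousfieldEmbedding T (sSup S)) := by
  refine ⟨?_, fun a ha Y hY => ?_⟩
  · rintro _ ⟨C, hC, rfl⟩
    exact (bousfieldEmbedding T).monotone (le_sSup hC)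
  · have : sSup S ≤ annihilatorOf Y := sSup_le fun C hC X hX =>
      (annihilatorOf_prop (C.le_compact X hX)).2 (ha ⟨C, hC, rfl⟩ Y hY X hX)
    exact fun X hX => (annihilatorOf_prop ((sSup S).le_compact X hX)).1 (this X hX)

lemma isGLB_bousfieldEmbedding_inf (C D : ThickTensorIdeal T) :
    IsGLB {bousfieldEmbedding T C, bousfieldEmbedding T D} (bousfieldEmbedding T (C ⊓ D)) := by
  refine ⟨?_, fun a ha Y hY => ?_⟩
  · rintro _ (rfl | rfl)
    exacts [(bousfieldEmbedding T).monotone inf_le_left,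
      (bousfieldEmbedding T).monotone inf_le_right]
  · obtain ⟨Z, hZ⟩ := a.exists_eq
    have hC : C.annihilator ≤ acyclics Z := hZ ▸ ha (Set.mem_insert _ _)
    have hD : D.annihilator ≤ acyclics Z := hZ ▸ ha (Set.mem_insert_of_mem _ rfl)
    obtain ⟨Γ, L, -, h₂, h₃, h₄, -⟩ := C.exists_idempotent_triangle
    obtain ⟨e⟩ := h₂ Z (hC L h₃)
    rw [hZ]
    -- Since `Z ≅ Z ⊗ Γ`, it suffices that `D` kills `Γ ⊗ Y`, i.e. that `Γ` kills `X ⊗ Y` for `X` in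
    -- `D`. This holds as `W ⊗ X` lies in both ideals for `W` in `C`.
    refine (hD (Γ ⊗ Y) fun X hX => ?_).of_iso (whiskerRightIso e Y ≪≫ α_ Z Γ Y)
    refine (h₄ (X ⊗ Y) fun W hW => ?_).of_iso (tensorLeftComm X Γ Y)
    exact isZero_tensor_assoc.1 (hY (W ⊗ X) (inf_prop.2
      ⟨C.tensor_mem W X hW (D.le_compact X hX), tensor_mem_right (C.le_compact W hW) hX⟩))

end ThickTensorIdeal

end TensorTriangulated

theorem theorem7 {T : Type u} [Category.{v} T] [HasZeroObject T] [HasShift T ℤ] [Preadditive T]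
    [∀ n : ℤ, (shiftFunctor T n).Additive] [Pretriangulated T] [IsTriangulated T]
    [MonoidalCategory T] [SymmetricCategory T] [HasCoproducts.{v} T] [CompactlyGenerated T] :
    IsCoherentFrame (ThickTensorIdeal T) ∧
    ∃ f : ThickTensorIdeal T ↪o BousfieldLattice T,
      -- `f C` is the supremum of the `A(X)` with `X` in `C`
      (∀ C, IsLUB (bousfieldClass '' {X | C.prop X}) (f C)) ∧
      -- `f` preserves binary infima and arbitrary suprema, all of them taken in `A(T)`
      (∀ C D, IsGLB {f C, f D} (f (C ⊓ D))) ∧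
      (∀ S : Set (ThickTensorIdeal T), IsLUB (f '' S) (f (sSup S))) ∧
      -- the image consists of the suprema of the `A(X)` for arbitrary classes of compact objects
      (∀ P : ObjectProperty T, P ≤ compactObjects T →
        ∃ a : BousfieldLattice T, IsLUB (bousfieldClass '' {X | P X}) a) ∧
      Set.range f = {a | ∃ P : ObjectProperty T, P ≤ compactObjects T ∧
        IsLUB (bousfieldClass '' {X | P X}) a} ∧
      -- the image consists of Bousfield idempotent classes
      Set.range f ⊆ bousfieldIdempotents T := by
  refine ⟨ThickTensorIdeal.isCoherentFrame T, ThickTensorIdeal.bousfieldEmbedding T,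
    ThickTensorIdeal.isLUB_bousfieldEmbedding, ThickTensorIdeal.isGLB_bousfieldEmbedding_inf,
    ThickTensorIdeal.isLUB_bousfieldEmbedding_sSup,
    fun P hP => ⟨_, ThickTensorIdeal.isLUB_bousfieldEmbedding_generate hP⟩, ?_, ?_⟩
  · ext a
    constructor
    · rintro ⟨C, rfl⟩
      exact ⟨C.prop, C.le_compact, ThickTensorIdeal.isLUB_bousfieldEmbedding C⟩
    · rintro ⟨P, hP, ha⟩
      exact ⟨_, (ThickTensorIdeal.isLUB_bousfieldEmbedding_generate hP).unique ha⟩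
  · rintro _ ⟨C, rfl⟩
    exact C.toBousfield_mem_bousfieldIdempotents
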